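/- Let $n \ge 0$, let $M_n$ be the complex $n\times n$ matrices, and let $M_n^d$ be the space of linear functionals on $M_n$. Order $M_n$ by positive semidefiniteness and $M_n^d$ by positive functionals ($f(X)\ge 0$ for all $X \ge 0$). These are the first levels of the following matrix orderings: $(A_{ij})\in M_p(M_n)$ is positive if it is positive semidefinite as a $pn\times pn$ matrix, and $(f_{ij})\in M_p(M_n^d)$ is positive if the map $M_n\to M_p$, $X\mapsto (f_{ij}(X))$, is completely positive. An \emph{order isomorphism} (respectively, a \emph{complete order isomorphism}) is an invertible linear map $\Psi$ such that $\Psi$ and $\Psi^{-1}$ are positive (respectively, completely positive, that is, all amplifications $(v_{ij})\mapsto(\Psi(v_{ij}))$, $p\ge 1$, and those of $\Psi^{-1}$ are positive). Let $\mathcal B$ be a basis of $M_n$. Its \emph{duality map} $\mathcal D_{\mathcal B}: M_n\to M_n^d$ is the linear map that takes each member of $\mathcal B$ to the corresponding member of the dual basis. Let $\mathcal E=\{E_{ij}\}$ be the basis of matrix units, let $C_{\mathcal B}: M_n\to M_n$ be any linear map taking the set $\mathcal E$ to the set $\mathcal B$, let $C_{\mathcal B}^T$ be the linear map on $M_n$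 whose matrix in the basis $\mathcal E$ is the transpose of the matrix of $C_{\mathcal B}$, and put $M_{\mathcal B}=C_{\mathcal B}C_{\mathcal B}^T$ (which does not depend on the choice of $C_{\mathcal B}$). For $C\in M_n$ let $\Phi_C(X)=CXC^*$, and let $t(X)=X^t$ be the transpose map on $M_n$. Then $\mathcal D_{\mathcal B}$ is an order isomorphism if and only if there exists $C\in M_n$ such that either (1) $M_{\mathcal B}=\Phi_C$ or (2) $M_{\mathcal B}=t\circ\Phi_C$. If (1) holds for some $C \in M_n$, then $\mathcal D_{\mathcal B}$ is a complete order isomorphism. If (2) holds for some $C \in M_n$, then $\mathcal D_{\mathcal B}$ is a co-positive order isomorphism, that is, its composition with the transpose is a complete order isomorphism from $M_n$ to $M_n^d$; this holds for the transpose on either side, that is, both for $X\mapsto \mathcal D_{\mathcal B}(X^t)$ and for $X\mapsto \mathcal D_{\mathcal B}(X)\circ t$. -/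

import Mathlib

open scoped ComplexOrder

noncomputable section

namespace MatrixDuality

/-- `M_n`, the complex `n × n` matrices. -/
abbrev Mat (n : ℕ) : Type := Matrix (Fin n) (Fin n) ℂ

/-- The data of a matrix ordering on `V`: for each `p`, the set `M_p(V)⁺` of positive elements of
the `p × p` matrices over `V`. Only the concrete families `matCones` and `dualCones` are used. -/
abbrev MatrixCones (V : Type*) : Type _ := (p : ℕ) → Set (Matrix (Fin p) (Fin p) V)

/-- The matrix ordering of `M_n`: a block matrix in `M_p(M_n)` is positive when the
`pn × pn` scalar matrix it defines is positive semidefinite. -/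
def matCones (n : ℕ) : MatrixCones (Mat n) :=
  fun p => {A | (Matrix.comp (Fin p) (Fin p) (Fin n) (Fin n) ℂ A).PosSemidef}

section General

variable {V W : Type*} [AddCommGroup V] [Module ℂ V] [AddCommGroup W] [Module ℂ W]

/-- `Φ` is completely positive: every amplification `(v_{ij}) ↦ (Φ v_{ij})` is positive. -/
def IsCompletelyPositive (P : MatrixCones V) (Q : MatrixCones W) (Φ : V →ₗ[ℂ] W) : Prop :=
  ∀ (p : ℕ) (A : Matrix (Fin p) (Fin p) V), A ∈ P p → A.map Φ ∈ Q p

/-- The linear map `v ↦ (f_{ij}(v))` from `V` to `M_p` given by a matrix of functionals. -/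
def functionalMatrixMap {p : ℕ} (F : Matrix (Fin p) (Fin p) (Module.Dual ℂ V)) :
    V →ₗ[ℂ] Mat p where
  toFun v := Matrix.of fun i j => F i j v
  map_add' v w := by ext i j; simp
  map_smul' c v := by ext i j; simp

/-- The matrix ordering of the dual: `(f_{ij})` is positive when the map `v ↦ (f_{ij}(v))` into
`M_p` is completely positive. -/
def dualCones (P : MatrixCones V) : MatrixCones (Module.Dual ℂ V) :=
  fun p => {F | IsCompletelyPositive P (matCones p) (functionalMatrixMap F)}

/-- `Φ` is invertible, and `Φ` and `Φ⁻¹` are completely positive. -/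
def IsCompleteOrderIso (P : MatrixCones V) (Q : MatrixCones W) (Φ : V →ₗ[ℂ] W) : Prop :=
  ∃ e : V ≃ₗ[ℂ] W, (e : V →ₗ[ℂ] W) = Φ ∧
    IsCompletelyPositive P Q (e : V →ₗ[ℂ] W) ∧ IsCompletelyPositive Q P (e.symm : W →ₗ[ℂ] V)

/-- `Φ` is invertible, and `Φ` and `Φ⁻¹` map positive elements to positive elements. -/
def IsOrderIso (P : Set V) (Q : Set W) (Φ : V →ₗ[ℂ] W) : Prop :=
  ∃ e : V ≃ₗ[ℂ] W, (e : V →ₗ[ℂ] W) = Φ ∧ (∀ v ∈ P, e v ∈ Q) ∧ (∀ w ∈ Q, e.symm w ∈ P)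

end General

/-- The positive elements of `M_n`. -/
def posMat (n : ℕ) : Set (Mat n) := {X | X.PosSemidef}

/-- The positive functionals on `M_n`. -/
def posFunctional (n : ℕ) : Set (Module.Dual ℂ (Mat n)) :=
  {f | ∀ X : Mat n, X.PosSemidef → 0 ≤ f X}

/-- The order on `M_n` is the first level of its matrix ordering. -/
theorem mem_posMat_iff {n : ℕ} (X : Mat n) :
    X ∈ posMat n ↔ (Matrix.of fun _ _ : Fin 1 => X) ∈ matCones n 1 := by
  have h : X = (Matrix.comp (Fin 1) (Fin 1) (Fin n) (Fin n) ℂ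
      (Matrix.of fun _ _ : Fin 1 => X)).submatrix (fun i => (0, i)) (fun i => (0, i)) := by
    ext i j; rfl
  constructor
  · intro hX
    exact Matrix.PosSemidef.submatrix (M := X) hX (Prod.snd : Fin 1 × Fin n → Fin n)
  · intro hX
    have hX' : (Matrix.comp (Fin 1) (Fin 1) (Fin n) (Fin n) ℂ
      (Matrix.of fun _ _ : Fin 1 => X)).PosSemidef := hX
    change X.PosSemidef
    rw [h]
    exact hX'.submatrix _

/-- A complex matrix with a nonnegative quadratic form is positive semidefinite. -/
theorem posSemidef_of_forall_nonneg {p : ℕ} (G : Mat p)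
    (h : ∀ x : Fin p → ℂ, 0 ≤ star x ⬝ᵥ (G.mulVec x)) : G.PosSemidef := by
  rw [← Matrix.isPositive_toEuclideanLin_iff, LinearMap.isPositive_iff_complex]
  intro x
  have key : inner ℂ (G.toEuclideanLin x) x = star (star x.ofLp ⬝ᵥ (G.mulVec x.ofLp)) := by
    rw [EuclideanSpace.inner_eq_star_dotProduct, Matrix.ofLp_toLpLin, Matrix.toLin'_apply,
      ← Matrix.star_dotProduct, dotProduct_comm]
  have h2 : 0 ≤ inner ℂ (G.toEuclideanLin x) x := by
    rw [key]
    exact star_nonneg_iff.2 (h x.ofLp)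
  have h3 := Complex.nonneg_iff.1 h2
  exact ⟨Complex.ext rfl h3.2, h3.1⟩

/-- The order on the dual of `M_n` by positive functionals is the first level of its matrix
ordering. -/
theorem mem_posFunctional_iff {n : ℕ} (f : Module.Dual ℂ (Mat n)) :
    f ∈ posFunctional n ↔ (Matrix.of fun _ _ : Fin 1 => f) ∈ dualCones (matCones n) 1 := by
  constructor
  · intro hf p A hA
    have hA' : (Matrix.comp (Fin p) (Fin p) (Fin n) (Fin n) ℂ A).PosSemidef := hA
    have hG : (Matrix.of fun i j => f (A i j) : Mat p).PosSemidef := by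
      refine posSemidef_of_forall_nonneg _ fun x => ?_
      let Q : Matrix (Fin p × Fin n) (Fin n) ℂ := Matrix.of fun ia b => if ia.2 = b then x ia.1 else 0
      have h1 := hf _ (hA'.conjTranspose_mul_mul_same Q)
      have h2 : Q.conjTranspose * Matrix.comp (Fin p) (Fin p) (Fin n) (Fin n) ℂ A * Q =
          ∑ i, ∑ j, (star (x i) * x j) • A i j := by
        ext a b
        simp only [Matrix.mul_apply, Q, Matrix.conjTranspose_apply, Matrix.of_apply,
          Matrix.comp_apply, Fintype.sum_prod_type, Matrix.sum_apply, Matrix.smul_apply]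
        simp only [apply_ite star, star_zero, ite_mul, zero_mul, mul_ite, mul_zero,
          Finset.sum_ite_eq', Finset.mem_univ, if_true, Finset.sum_mul, smul_eq_mul]
        rw [Finset.sum_comm]
        exact Finset.sum_congr rfl fun i _ => Finset.sum_congr rfl fun j _ => by ring
      rw [h2] at h1
      convert h1 using 1
      simp only [map_sum, map_smul, dotProduct, Matrix.mulVec, Matrix.of_apply, Finset.mul_sum,
        smul_eq_mul, Pi.star_apply]
      exact Finset.sum_congr rfl fun i _ => Finset.sum_congr rfl fun j _ => by ring
    exact hG.submatrix (Prod.fst : Fin p × Fin 1 → Fin p)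
  · intro h X hX
    have h1 := h 1 _ ((mem_posMat_iff X).1 hX)
    have h2 : (Matrix.comp (Fin 1) (Fin 1) (Fin 1) (Fin 1) ℂ ((Matrix.of fun _ _ : Fin 1 => X).map
      (functionalMatrixMap (Matrix.of fun _ _ : Fin 1 => f)))).PosSemidef := h1
    exact h2.diag_nonneg (i := (0, 0))

/-- The standard basis of matrix units `E_{ij}`. -/
abbrev matrixUnits (n : ℕ) : Module.Basis (Fin n × Fin n) ℂ (Mat n) :=
  Matrix.stdBasis ℂ (Fin n) (Fin n)

/-- The duality map of a basis of `M_n`: the linear map that takes each member of the basis to the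
corresponding member of the dual basis. -/
abbrev dualityMap {n : ℕ} {ι : Type*} [DecidableEq ι] (B : Module.Basis ι ℂ (Mat n)) :
    Mat n →ₗ[ℂ] Module.Dual ℂ (Mat n) :=
  B.toDual

/-- The transpose of a linear map on `M_n`, formed on its matrix in the basis of matrix units. -/
def superTranspose {n : ℕ} (L : Mat n →ₗ[ℂ] Mat n) : Mat n →ₗ[ℂ] Mat n :=
  Matrix.toLin (matrixUnits n) (matrixUnits n)
    (LinearMap.toMatrix (matrixUnits n) (matrixUnits n) L).transpose

/-- `L` is a change of basis map for `B`: it takes the set of matrix units to the set `B`. -/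
def IsChangeOfBasis {n : ℕ} {ι : Type*} (B : Module.Basis ι ℂ (Mat n))
    (L : Mat n →ₗ[ℂ] Mat n) : Prop :=
  L '' Set.range (matrixUnits n) = Set.range B

/-- Change of basis maps exist for every basis. -/
theorem exists_isChangeOfBasis {n : ℕ} {ι : Type*} (B : Module.Basis ι ℂ (Mat n)) :
    ∃ L : Mat n →ₗ[ℂ] Mat n, IsChangeOfBasis B L := by
  let e := (matrixUnits n).indexEquiv B
  refine ⟨(matrixUnits n).constr ℂ (B ∘ e), ?_⟩
  unfold IsChangeOfBasis
  rw [← Set.range_comp]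
  have h : ((matrixUnits n).constr ℂ (B ∘ e) : Mat n → Mat n) ∘ (matrixUnits n) = B ∘ e := by
    funext i
    exact Module.Basis.constr_basis _ _ _ _
  rw [h, e.surjective.range_comp]

/-- The map `Φ_C : X ↦ C X C*` on `M_n`. -/
def conjMap {n : ℕ} (C : Mat n) : Mat n →ₗ[ℂ] Mat n where
  toFun X := C * X * C.conjTranspose
  map_add' X Y := by simp [mul_add, add_mul]
  map_smul' c X := by simp

/-- The transpose map `t` on `M_n`. -/
def transposeMap (n : ℕ) : Mat n →ₗ[ℂ] Mat n :=
  (Matrix.transposeLinearEquiv (Fin n) (Fin n) ℂ ℂ : Mat n ≃ₗ[ℂ] Mat n)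

/-- A map `D` from `M_n` to its dual is a co-positive order isomorphism when its composition with
the transpose is a complete order isomorphism. We ask for this with the transpose on either side:
for `D ∘ t`, and for `t' ∘ D`, where `t' f = f ∘ t` is the transpose on the dual. -/
def IsCoPositiveOrderIso {n : ℕ} (D : Mat n →ₗ[ℂ] Module.Dual ℂ (Mat n)) : Prop :=
  IsCompleteOrderIso (matCones n) (dualCones (matCones n)) (D ∘ₗ transposeMap n) ∧
  IsCompleteOrderIso (matCones n) (dualCones (matCones n)) ((transposeMap n).dualMap ∘ₗ D)

end MatrixDuality

end

open scoped ComplexOrder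

noncomputable section

namespace MatrixDuality

open Matrix

/-! Write `D_B`, `D_E` for the duality maps of the basis and of the matrix units. Since `C_B`
carries units to basis members and its transpose is its adjoint for the pairing `∑ X_ab Y_ab`, one
gets `D_B ∘ M_B = D_E` (`dualityMap_comp_eq_toDual`). By a Choi matrix argument `D_E` preserves and
reflects every level of the matrix orderings (`map_toDual_mem_dualCones_iff`). So `D_B` is an order
isomorphism exactly when `M_B` is an order automorphism, and the complete statements follow by
solving for `D_B`.

It remains to classify order automorphisms `L` (`exists_conjMap_of_orderAutomorphism`). Such an `L`
maps each `x x*` to some `y y*`, since these matrices dominate only their own multiples. Composing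
with a congruence makes `L` fix every `E_ii`. Then `L` preserves diagonals, and rank one forces
`|L(x x*)_kl| = |x_k| |x_l|`. Hence `L(X)_kl` is a multiple of `X_kl` or of `X_lk`; vanishing minors
make this choice uniform off the diagonal, and the image of the all-ones matrix shows that the
multipliers are `y_k conj(y_l)`. -/

/-! ### Rank-one positive matrices under order automorphisms -/

/-- A positive semidefinite matrix dominated by `x x*` is a multiple of `x x*`. -/
theorem eq_smul_vecMulVec_of_posSemidef_sub {n : ℕ} {Z : Mat n} {x : Fin n → ℂ}
    (hZ : Z.PosSemidef) (h : (vecMulVec x (star x) - Z).PosSemidef) :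
    ∃ c : ℂ, Z = c • vecMulVec x (star x) := by
  -- On the orthogonal complement of `x` the form of `Z` is squeezed between `0` and `0`, so `Z`
  -- kills it.
  have key : ∀ u, star x ⬝ᵥ u = 0 → Z *ᵥ u = 0 := by
    intro u hu
    rw [← hZ.dotProduct_mulVec_zero_iff]
    have h1 := h.dotProduct_mulVec_nonneg u
    rw [sub_mulVec, vecMulVec_mulVec, hu] at h1
    simp only [MulOpposite.op_zero, zero_smul, zero_sub, dotProduct_neg] at h1
    exact le_antisymm (neg_nonneg.1 h1) (hZ.dotProduct_mulVec_nonneg u)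
  by_cases hx : x = 0
  · refine ⟨0, ?_⟩
    rw [zero_smul]
    refine Matrix.ext_of_mulVec_single fun i => ?_
    rw [key _ (by simp [hx]), zero_mulVec]
  have hs : star x ⬝ᵥ x ≠ 0 := by rwa [Ne, dotProduct_star_self_eq_zero]
  have h1 : Z = (star x ⬝ᵥ x)⁻¹ • vecMulVec (Z *ᵥ x) (star x) := by
    refine Matrix.ext_of_mulVec_single fun i => ?_
    have h2 := key ((star x ⬝ᵥ x) • Pi.single i 1 - (star x ⬝ᵥ Pi.single i 1) • x) (by
      simp [dotProduct_sub, dotProduct_smul, mul_comm])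
    rw [mulVec_sub, mulVec_smul, mulVec_smul, sub_eq_zero] at h2
    rw [smul_mulVec, vecMulVec_mulVec, op_smul_eq_smul, ← h2, smul_smul, inv_mul_cancel₀ hs,
      one_smul]
  have h2 : Z = (star (star x ⬝ᵥ x))⁻¹ • vecMulVec x (star (Z *ᵥ x)) := by
    have h3 := congrArg conjTranspose h1
    rwa [hZ.isHermitian.eq, conjTranspose_smul, conjTranspose_vecMulVec, star_star,
      star_inv₀] at h3
  have h3 : Z *ᵥ x = ((star (star x ⬝ᵥ x))⁻¹ * (star (Z *ᵥ x) ⬝ᵥ x)) • x := by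
    conv_lhs => rw [h2]
    rw [smul_mulVec, vecMulVec_mulVec, op_smul_eq_smul, smul_smul]
  rw [h3, smul_vecMulVec, smul_smul] at h1
  exact ⟨_, h1⟩

/-- A nonzero positive semidefinite matrix dominates some nonzero `v v*`. -/
theorem exists_vecMulVec_le {n : ℕ} {A : Mat n} (hA : A.PosSemidef) (h0 : A ≠ 0) :
    ∃ v : Fin n → ℂ, vecMulVec v (star v) ≠ 0 ∧ (A - vecMulVec v (star v)).PosSemidef := by
  obtain ⟨B, rfl⟩ : ∃ B : Mat n, A = Bᴴ * B := by
    open scoped MatrixOrder in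
    exact CStarAlgebra.nonneg_iff_eq_star_mul_self.mp hA.nonneg
  have hsum : Bᴴ * B = ∑ k, vecMulVec (star (B k)) (star (star (B k))) := by
    ext i j
    simp [mul_apply, Matrix.sum_apply, vecMulVec_apply]
  have hB : ∃ k, vecMulVec (star (B k)) (star (star (B k))) ≠ 0 := by
    by_contra! hc
    exact h0 (by rw [hsum]; exact Finset.sum_eq_zero fun k _ => hc k)
  obtain ⟨k, hk⟩ := hB
  refine ⟨star (B k), hk, ?_⟩
  rw [hsum, ← Finset.add_sum_erase _ _ (Finset.mem_univ k), add_sub_cancel_left]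
  exact posSemidef_sum _ fun i _ => posSemidef_vecMulVec_self_star _

/-- An order automorphism of `M_n` maps each `x x*` to some `y y*`. -/
theorem exists_map_vecMulVec {n : ℕ} {L : Mat n →ₗ[ℂ] Mat n} (hL : Function.Bijective L)
    (hp : ∀ X, (L X).PosSemidef ↔ X.PosSemidef) (x : Fin n → ℂ) :
    ∃ y, L (vecMulVec x (star x)) = vecMulVec y (star y) := by
  by_cases h0 : L (vecMulVec x (star x)) = 0
  · exact ⟨0, by simp [h0]⟩
  have hA := (hp _).2 (posSemidef_vecMulVec_self_star x)
  obtain ⟨v, hv0, hv⟩ := exists_vecMulVec_le hA h0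
  -- The preimage of `v v*` lies between `0` and `x x*`, so it is `c x x*`. A diagonal entry then
  -- shows `c > 0`, and `v / √c` is the required vector.
  obtain ⟨Z, hZ⟩ := hL.surjective (vecMulVec v (star v))
  rw [← hZ, ← map_sub, hp] at hv
  obtain ⟨c, rfl⟩ := eq_smul_vecMulVec_of_posSemidef_sub
    ((hp Z).1 (hZ ▸ posSemidef_vecMulVec_self_star v)) hv
  rw [map_smul] at hZ
  have hc : c ≠ 0 := by
    rintro rfl
    rw [zero_smul] at hZ
    exact hv0 hZ.symm
  obtain ⟨i, hi⟩ : ∃ i, v i ≠ 0 := by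
    by_contra! h
    exact hv0 (by rw [show v = 0 from funext h]; simp)
  have h1 : c * L (vecMulVec x (star x)) i i = v i * star (v i) := by
    simpa [vecMulVec_apply] using congrFun (congrFun hZ i) i
  have h2 : 0 < v i * star (v i) := by
    rw [RCLike.star_def, Complex.mul_conj]
    exact_mod_cast Complex.normSq_pos.2 hi
  have h3 : 0 < c := by
    have h4 := hA.diag_nonneg (i := i)
    have h5 : L (vecMulVec x (star x)) i i ≠ 0 := by
      intro h
      rw [h, mul_zero] at h1
      exact h2.ne h1
    have h6 : 0 < L (vecMulVec x (star x)) i i := lt_of_le_of_ne h4 h5.symm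
    rw [← h1] at h2
    exact pos_of_mul_pos_left h2 h4
  obtain ⟨r, hr, rfl⟩ : ∃ r : ℝ, 0 < r ∧ (r : ℂ) = c := by
    have := Complex.pos_iff.1 h3
    exact ⟨c.re, this.1, Complex.ext rfl (by simpa using this.2)⟩
  refine ⟨((Real.sqrt r)⁻¹ : ℂ) • v, ?_⟩
  have hss : ((Real.sqrt r : ℝ) : ℂ) * (Real.sqrt r : ℝ) = r := by
    exact_mod_cast Real.mul_self_sqrt hr.le
  rw [star_smul, smul_vecMulVec, vecMulVec_smul, smul_smul, ← hZ, smul_smul]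
  have : ((Real.sqrt r : ℝ) : ℂ)⁻¹ * star (((Real.sqrt r : ℝ) : ℂ)⁻¹) * r = 1 := by
    have : ((Real.sqrt r : ℝ) : ℂ) ≠ 0 := by
      exact_mod_cast (Real.sqrt_pos.2 hr).ne'
    rw [star_inv₀, RCLike.star_def, Complex.conj_ofReal, ← hss]
    field_simp
  rw [this, one_smul]

/-! ### Positive maps fixing the diagonal matrix units -/

/-- A positive functional that vanishes at `E_ii` vanishes at `E_ij` and `E_ji`. -/
theorem map_single_eq_zero {n : ℕ} {f : Module.Dual ℂ (Mat n)} (hf : f ∈ posFunctional n)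
    {i : Fin n} (hi : f (single i i 1) = 0) (j : Fin n) :
    f (single i j 1) = 0 ∧ f (single j i 1) = 0 := by
  have hG : (of fun i j => f (single i j 1) : Mat n).PosSemidef := by
    refine posSemidef_of_forall_nonneg _ fun x => ?_
    have h1 := hf _ (posSemidef_vecMulVec_star_self x)
    rw [matrix_eq_sum_single (vecMulVec (star x) x)] at h1
    convert h1 using 1
    simp only [dotProduct, mulVec, of_apply, map_sum, Finset.mul_sum]
    refine Finset.sum_congr rfl fun i _ => Finset.sum_congr rfl fun j _ => ?_
    have hs (c : ℂ) : (single i j c : Mat n) = c • single i j 1 := by simp [smul_single]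
    rw [vecMulVec_apply, hs (star x i * x j), map_smul, smul_eq_mul]
    ring
  have h1 := (hG.dotProduct_mulVec_zero_iff (Pi.single i 1)).1 (by simp [hi])
  have h2 : f (single j i 1) = 0 := by simpa using congrFun h1 j
  refine ⟨?_, h2⟩
  have h3 := hG.isHermitian.apply i j
  simp only [of_apply, h2, star_zero] at h3
  exact h3.symm

theorem linearMap_ext_single {n : ℕ} {W : Type*} [AddCommGroup W] [Module ℂ W]
    {f g : Mat n →ₗ[ℂ] W} (h : ∀ i j, f (single i j 1) = g (single i j 1)) : f = g :=
  (matrixUnits n).ext fun ⟨i, j⟩ => by simpa [stdBasis_eq_single] using h i j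

/-- The functional `X ↦ L(X)_{kl}`. -/
def entry {n : ℕ} (L : Mat n →ₗ[ℂ] Mat n) (k l : Fin n) : Module.Dual ℂ (Mat n) :=
  entryLinearMap ℂ ℂ k l ∘ₗ L

theorem entry_apply {n : ℕ} (L : Mat n →ₗ[ℂ] Mat n) (k l : Fin n) (X : Mat n) :
    entry L k l X = L X k l := rfl

/-- A unital-on-the-diagonal positive map preserves diagonals. -/
theorem map_apply_self {n : ℕ} {L : Mat n →ₗ[ℂ] Mat n}
    (hp : ∀ X, X.PosSemidef → (L X).PosSemidef)
    (hd : ∀ i, L (single i i 1) = single i i 1) (X : Mat n) (k : Fin n) :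
    L X k k = X k k := by
  have hf : entry L k k ∈ posFunctional n := fun X hX => (hp X hX).diag_nonneg
  suffices h : entry L k k = entry LinearMap.id k k by
    simpa [entry_apply] using LinearMap.congr_fun h X
  refine linearMap_ext_single fun i j => ?_
  by_cases hij : i = j
  · subst hij
    simp [entry_apply, hd]
  · have hne : ¬ (i = k ∧ j = k) := fun h => hij (h.1.trans h.2.symm)
    rw [entry_apply LinearMap.id, LinearMap.id_apply, single_apply_of_ne _ _ _ _ _ hne]
    -- As `i ≠ j`, one of the two indices differs from `k`; the functional vanishes at that diagonal
    -- unit, hence on its row and column.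
    by_cases hik : i = k
    · have hjk : j ≠ k := fun h => hij (hik.trans h.symm)
      exact (map_single_eq_zero hf (by simp [entry_apply, hd, hjk]) i).2
    · exact (map_single_eq_zero hf (by simp [entry_apply, hd, hik]) j).1

theorem vecMulVec_polarization {n : ℕ} (u v : Fin n → ℂ) :
    (4 : ℂ) • vecMulVec u (star v) = vecMulVec (u + v) (star (u + v))
      - vecMulVec (u - v) (star (u - v))
      + Complex.I • vecMulVec (u + Complex.I • v) (star (u + Complex.I • v))
      - Complex.I • vecMulVec (u - Complex.I • v) (star (u - Complex.I • v)) := by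
  ext i j
  simp [vecMulVec_apply]
  linear_combination (2 * u i * starRingEnd ℂ (v j) - 2 * v i * starRingEnd ℂ (u j)) *
    Complex.I_mul_I

/-- The values `1`, `i`, `1 + i` of `w` force the real and imaginary parts of `q conj(r)` to vanish.
-/
theorem eq_zero_or_eq_zero_of_normSq {q r : ℂ}
    (h : ∀ w : ℂ, Complex.normSq (q * star w + r * w) = Complex.normSq w) :
    (r = 0 ∧ q ≠ 0) ∨ (q = 0 ∧ r ≠ 0) := by
  have h1 := h 1
  have h2 := h Complex.I
  have h3 := h (1 + Complex.I)
  simp [Complex.normSq_apply] at h1 h2 h3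
  have h4 : q.re * r.re + q.im * r.im = 0 := by linarith
  have h5 : q.im * r.re - q.re * r.im = 0 := by linarith
  have h6 : Complex.normSq q * Complex.normSq r = 0 := by
    rw [Complex.normSq_apply, Complex.normSq_apply]
    linear_combination (q.re * r.re + q.im * r.im) * h4 + (q.im * r.re - q.re * r.im) * h5
  rcases mul_eq_zero.1 h6 with h7 | h7
  · have hq := Complex.normSq_eq_zero.1 h7
    refine Or.inr ⟨hq, ?_⟩
    rintro rfl
    simp [hq] at h1
  · have hr := Complex.normSq_eq_zero.1 h7
    refine Or.inl ⟨hr, ?_⟩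
    rintro rfl
    simp [hr] at h1

section Normalized

variable {n : ℕ} {L : Mat n →ₗ[ℂ] Mat n}

/-- The 2 × 2 minors of `y y*` vanish. -/
theorem minor_eq (hr : ∀ x, ∃ y, L (vecMulVec x (star x)) = vecMulVec y (star y))
    (x : Fin n → ℂ) (a b c d : Fin n) :
    L (vecMulVec x (star x)) a b * L (vecMulVec x (star x)) c d =
      L (vecMulVec x (star x)) a d * L (vecMulVec x (star x)) c b := by
  obtain ⟨y, hy⟩ := hr x
  simp only [hy, vecMulVec_apply]
  ring

theorem normSq_map_vecMulVec (hp : ∀ X, X.PosSemidef → (L X).PosSemidef)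
    (hd : ∀ i, L (single i i 1) = single i i 1)
    (hr : ∀ x, ∃ y, L (vecMulVec x (star x)) = vecMulVec y (star y))
    (x : Fin n → ℂ) (k l : Fin n) :
    Complex.normSq (L (vecMulVec x (star x)) k l) =
      Complex.normSq (x k) * Complex.normSq (x l) := by
  have h1 := minor_eq hr x k l l k
  rw [map_apply_self hp hd, map_apply_self hp hd,
    ← (hp _ (posSemidef_vecMulVec_self_star x)).isHermitian.apply l k, vecMulVec_apply,
    vecMulVec_apply, Pi.star_apply, Pi.star_apply, RCLike.star_def, Complex.mul_conj, Complex.mul_conj,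
    Complex.mul_conj] at h1
  exact_mod_cast h1

/-- By polarization `E_ij` is a combination of `x x*` with `x = e_i + c e_j`, `c⁴ = 1`. Each such
`x` vanishes at `k` or at `l`, so the modulus formula kills the entry. -/
theorem map_single_apply_eq_zero (hp : ∀ X, X.PosSemidef → (L X).PosSemidef)
    (hd : ∀ i, L (single i i 1) = single i i 1)
    (hr : ∀ x, ∃ y, L (vecMulVec x (star x)) = vecMulVec y (star y))
    {i j k l : Fin n} (h : (i ≠ k ∧ j ≠ k) ∨ (i ≠ l ∧ j ≠ l)) :
    L (single i j 1) k l = 0 := by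
  have h0 : ∀ x : Fin n → ℂ, x k = 0 ∨ x l = 0 → L (vecMulVec x (star x)) k l = 0 := by
    intro x hx
    rw [← Complex.normSq_eq_zero, normSq_map_vecMulVec hp hd hr]
    rcases hx with hx | hx <;> simp [hx]
  have h1 : ∀ c : ℂ, L (vecMulVec (Pi.single i 1 + c • Pi.single j 1)
      (star (Pi.single i 1 + c • Pi.single j 1))) k l = 0 := by
    intro c
    refine h0 _ (h.imp ?_ ?_) <;> rintro ⟨h1, h2⟩ <;> simp [h1.symm, h2.symm]
  have h2 : (single i j 1 : Mat n) = vecMulVec (Pi.single i 1) (star (Pi.single j 1)) := by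
    simp [single_eq_single_vecMulVec_single]
  have h3 := congrArg (entry L k l) (vecMulVec_polarization (Pi.single i 1) (Pi.single j (1 : ℂ)))
  have h4 := h1 1
  have h5 := h1 (-1)
  have h6 := h1 Complex.I
  have h7 := h1 (-Complex.I)
  simp only [one_smul, neg_smul, ← sub_eq_add_neg] at h4 h5 h6 h7
  rw [← h2, map_smul, map_sub, map_add, map_sub, map_smul, map_smul] at h3
  simp only [entry_apply, h4, h5, h6, h7, smul_zero, sub_zero, add_zero] at h3
  simpa using h3

theorem exists_map_apply_eq (hp : ∀ X, X.PosSemidef → (L X).PosSemidef)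
    (hd : ∀ i, L (single i i 1) = single i i 1)
    (hr : ∀ x, ∃ y, L (vecMulVec x (star x)) = vecMulVec y (star y)) (k l : Fin n) :
    ∃ q r : ℂ, (∀ X, L X k l = q * X k l + r * X l k) ∧ ((r = 0 ∧ q ≠ 0) ∨ (q = 0 ∧ r ≠ 0)) := by
  by_cases hkl : k = l
  · subst hkl
    exact ⟨1, 0, fun X => by rw [map_apply_self hp hd]; ring, by simp⟩
  have hlk : l ≠ k := fun h => hkl h.symm
  obtain ⟨q, hq⟩ : ∃ q, q = L (single k l 1) k l := ⟨_, rfl⟩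
  obtain ⟨r, hr'⟩ : ∃ r, r = L (single l k 1) k l := ⟨_, rfl⟩
  have hX : ∀ X, L X k l = q * X k l + r * X l k := by
    intro X
    suffices h : entry L k l = q • entry LinearMap.id k l + r • entry LinearMap.id l k by
      simpa [entry_apply] using LinearMap.congr_fun h X
    refine linearMap_ext_single fun i j => ?_
    simp only [LinearMap.add_apply, LinearMap.smul_apply, entry_apply, LinearMap.id_apply,
      smul_eq_mul]
    by_cases h1 : i = k ∧ j = l
    · obtain ⟨rfl, rfl⟩ := h1
      simp [hq, hkl]
    by_cases h2 : i = l ∧ j = k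
    · obtain ⟨rfl, rfl⟩ := h2
      simp [hr', hkl]
    rw [map_single_apply_eq_zero hp hd hr (by grind), single_apply_of_ne _ _ _ _ _ h1,
      single_apply_of_ne _ _ _ _ _ h2]
    simp
  refine ⟨q, r, hX, eq_zero_or_eq_zero_of_normSq fun w => ?_⟩
  -- For `x = e_k + w e_l` the entry is `q conj(w) + r w`, of modulus `|w|`.
  have h1 := normSq_map_vecMulVec hp hd hr (Pi.single k 1 + w • Pi.single l 1) k l
  rw [hX] at h1
  simpa [vecMulVec_apply, hkl, hlk] using h1

/-- A rank-one preserving positive map that fixes the diagonal matrix units is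
`Φ_C` or `t ∘ Φ_C`. -/
theorem exists_conjMap_of_map_single (hp : ∀ X, X.PosSemidef → (L X).PosSemidef)
    (hd : ∀ i, L (single i i 1) = single i i 1)
    (hr : ∀ x, ∃ y, L (vecMulVec x (star x)) = vecMulVec y (star y)) :
    ∃ C : Mat n, L = conjMap C ∨ L = transposeMap n ∘ₗ conjMap C := by
  choose q r hX hqr using exists_map_apply_eq hp hd hr
  have prop : ∀ k l m, k ≠ l → l ≠ m → r k l = 0 → r l m = 0 := by
    intro k l m hkl hlm hrkl
    by_contra hne
    have hqlm : q l m = 0 := by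
      rcases hqr l m with h | h
      · exact absurd h.1 hne
      · exact h.1
    have hqkl : q k l ≠ 0 := by
      rcases hqr k l with h | h
      · exact h.2
      · exact absurd hrkl h.2
    -- If `(k,l)` were of direct type and `(l,m)` of transposed type, changing `x_l` from `1` to `i`
    -- would negate the left side of the minor identity and fix the right side.
    have h1 := minor_eq hr (fun _ => 1) k l l m
    have h2 := minor_eq hr (Function.update (fun _ => 1) l Complex.I) k l l m
    simp only [hX k l, hX l m, hX k m, map_apply_self hp hd, hrkl, hqlm, vecMulVec_apply,
      Pi.star_apply, Function.update_self, Function.update_of_ne hkl,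
      Function.update_of_ne hlm.symm] at h1 h2
    simp at h1 h2
    have h3 : q k l * r l m = 0 := by
      linear_combination (h1 - h2 + q k l * r l m * Complex.I_mul_I) / 2
    exact mul_ne_zero hqkl hne h3
  obtain ⟨y, hy⟩ := hr fun _ => 1
  have hy1 : ∀ k l, q k l + r k l = y k * star (y l) := by
    intro k l
    have := congrFun (congrFun hy k) l
    rw [hX k l] at this
    simpa [vecMulVec_apply] using this
  by_cases hs : ∃ a b, a ≠ b ∧ r a b = 0
  · obtain ⟨a, b, hab, hrab⟩ := hs
    have hall : ∀ k l, k ≠ l → r k l = 0 := by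
      intro k l hkl
      by_cases hbk : b = k
      · subst hbk
        exact prop a b l hab hkl hrab
      · exact prop b k l hbk hkl (prop a b k hab hbk hrab)
    refine ⟨diagonal y, Or.inl (LinearMap.ext fun X => ?_)⟩
    ext k l
    have h1 : conjMap (diagonal y) X k l = y k * star (y l) * X k l := by
      simp only [conjMap, LinearMap.coe_mk, AddHom.coe_mk, diagonal_conjTranspose, mul_diagonal,
        diagonal_mul, Pi.star_apply]
      ring
    rw [h1, ← hy1, hX]
    by_cases hkl : k = l
    · subst hkl; ring
    · rw [hall k l hkl]; ring
  · push Not at hs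
    have hall : ∀ k l, k ≠ l → q k l = 0 := fun k l hkl => by
      rcases hqr k l with h | h
      · exact absurd h.1 (hs k l hkl)
      · exact h.1
    refine ⟨diagonal (star y), Or.inr (LinearMap.ext fun X => ?_)⟩
    ext k l
    have h1 : (transposeMap n ∘ₗ conjMap (diagonal (star y))) X k l =
        y k * star (y l) * X l k := by
      change conjMap (diagonal (star y)) X l k = _
      simp only [conjMap, LinearMap.coe_mk, AddHom.coe_mk, diagonal_conjTranspose, mul_diagonal,
        diagonal_mul, Pi.star_apply, star_star]
      ring
    rw [h1, ← hy1, hX]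
    by_cases hkl : k = l
    · subst hkl; ring
    · rw [hall k l hkl]; ring

end Normalized

/-! ### Congruences and the classification of order automorphisms -/

theorem conjMap_apply {n : ℕ} (C X : Mat n) : conjMap C X = C * X * Cᴴ := rfl

theorem transposeMap_apply {n : ℕ} (X : Mat n) : transposeMap n X = Xᵀ := rfl

theorem conjMap_comp {n : ℕ} (C D : Mat n) : conjMap C ∘ₗ conjMap D = conjMap (C * D) :=
  LinearMap.ext fun X => by simp [conjMap_apply, mul_assoc]

theorem conjMap_comp_transposeMap {n : ℕ} (C : Mat n) :
    conjMap C ∘ₗ transposeMap n = transposeMap n ∘ₗ conjMap (C.map star) :=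
  LinearMap.ext fun X => by
    have h : ((C.map star)ᴴ)ᵀ = C := by ext i j; simp
    simp only [LinearMap.comp_apply, conjMap_apply, transposeMap_apply, transpose_mul, mul_assoc, h]
    rfl

theorem posSemidef_conjMap_iff {n : ℕ} {C : Mat n} (hC : IsUnit C) (X : Mat n) :
    (conjMap C X).PosSemidef ↔ X.PosSemidef :=
  IsUnit.posSemidef_star_right_conjugate_iff hC

/-- Every order automorphism of `M_n` has the form `Φ_C` or `t ∘ Φ_C`. -/
theorem exists_conjMap_of_orderAutomorphism {n : ℕ} {L : Mat n →ₗ[ℂ] Mat n}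
    (hL : Function.Bijective L) (hp : ∀ X, (L X).PosSemidef ↔ X.PosSemidef) :
    ∃ C : Mat n, L = conjMap C ∨ L = transposeMap n ∘ₗ conjMap C := by
  have hr := exists_map_vecMulVec hL hp
  have hsingle (i : Fin n) : (single i i 1 : Mat n) =
      vecMulVec (Pi.single i 1) (star (Pi.single i 1)) := by
    simp [single_eq_single_vecMulVec_single]
  choose y hy using fun i : Fin n => hr (Pi.single i 1)
  -- The columns of `F` are the `y i`, so `Φ_F` agrees with `L` on the `E_ii`; undoing `Φ_F`
  -- normalizes `L`.
  let F : Mat n := of fun a i => y i a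
  have hF1 : ∀ i, conjMap F (single i i 1) = L (single i i 1) := by
    intro i
    rw [hsingle, hy, conjMap_apply, mul_vecMulVec, vecMulVec_mul, ← star_mulVec]
    have : F *ᵥ Pi.single i 1 = y i := by ext a; simp [F]
    rw [this]
  have hF : IsUnit F := by
    rw [← isUnit_conjTranspose]
    rw [← mulVec_injective_iff_isUnit]
    rw [← coe_mulVecLin, ← LinearMap.ker_eq_bot, LinearMap.ker_eq_bot']
    intro u hu
    change Fᴴ *ᵥ u = 0 at hu
    -- For `u` in the kernel of `F*`, this positive functional vanishes at every `E_ii`, hence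
    -- everywhere; at a preimage of `1` it equals `u* u`.
    let f : Module.Dual ℂ (Mat n) :=
      { toFun := fun X => star u ⬝ᵥ (L X *ᵥ u)
        map_add' := fun X Y => by rw [map_add, add_mulVec, dotProduct_add]
        map_smul' := fun c X => by simp [smul_mulVec, dotProduct_smul] }
    have hf : f ∈ posFunctional n := fun X hX => ((hp X).2 hX).dotProduct_mulVec_nonneg u
    have hfi : ∀ i, f (single i i 1) = 0 := by
      intro i
      change star u ⬝ᵥ (L (single i i 1) *ᵥ u) = 0
      rw [← hF1, conjMap_apply, ← mulVec_mulVec, hu, mulVec_zero, dotProduct_zero]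
    have hf0 : f = 0 := linearMap_ext_single fun i j => (map_single_eq_zero hf (hfi i) j).1
    obtain ⟨X, hX⟩ := hL.surjective 1
    have : f X = 0 := by rw [hf0]; rfl
    change star u ⬝ᵥ (L X *ᵥ u) = 0 at this
    rwa [hX, one_mulVec, dotProduct_star_self_eq_zero] at this
  obtain ⟨G, hFG, hGF⟩ : ∃ G, F * G = 1 ∧ G * F = 1 := by
    obtain ⟨U, hU⟩ := hF
    exact hU ▸ ⟨_, U.mul_inv, U.inv_mul⟩
  have hG : IsUnit G := ⟨⟨G, F, hGF, hFG⟩, rfl⟩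
  have hid : conjMap (1 : Mat n) = LinearMap.id := LinearMap.ext fun X => by simp [conjMap_apply]
  have hcancel : L = conjMap F ∘ₗ (conjMap G ∘ₗ L) := by
    rw [← LinearMap.comp_assoc, conjMap_comp, hFG, hid, LinearMap.id_comp]
  obtain ⟨C, hC⟩ := exists_conjMap_of_map_single (L := conjMap G ∘ₗ L)
    (fun X hX => (posSemidef_conjMap_iff hG _).2 ((hp X).2 hX))
    (fun i => by
      rw [LinearMap.comp_apply, ← hF1, ← LinearMap.comp_apply, conjMap_comp, hGF, hid,
        LinearMap.id_apply])
    (fun x => by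
      obtain ⟨z, hz⟩ := hr x
      refine ⟨G *ᵥ z, ?_⟩
      rw [LinearMap.comp_apply, hz, conjMap_apply, mul_vecMulVec, vecMulVec_mul, ← star_mulVec])
  rcases hC with hC | hC
  · refine ⟨F * C, Or.inl ?_⟩
    rw [hcancel, hC, conjMap_comp]
  · refine ⟨F.map star * C, Or.inr ?_⟩
    rw [hcancel, hC, ← LinearMap.comp_assoc, conjMap_comp_transposeMap, LinearMap.comp_assoc,
      conjMap_comp]

/-! ### The duality map of the matrix units -/

theorem matrixUnits_toDual_apply {n : ℕ} (X Y : Mat n) :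
    (matrixUnits n).toDual X Y = ∑ a, ∑ b, X a b * Y a b := by
  conv_lhs => rw [matrix_eq_sum_single Y]
  simp only [map_sum]
  refine Finset.sum_congr rfl fun a _ => Finset.sum_congr rfl fun b _ => ?_
  have h : (single a b (Y a b) : Mat n) = Y a b • matrixUnits n (a, b) := by
    simp [stdBasis_eq_single, smul_single]
  rw [h, map_smul, Module.Basis.toDual_apply_left, smul_eq_mul, mul_comm]
  rfl

theorem matrixUnits_toDual_transpose {n : ℕ} (X Y : Mat n) :
    (matrixUnits n).toDual X Yᵀ = (matrixUnits n).toDual Xᵀ Y := by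
  rw [matrixUnits_toDual_apply, matrixUnits_toDual_apply, Finset.sum_comm]
  rfl

/-- Summing the entries within each block preserves positive semidefiniteness. -/
theorem posSemidef_sum_blocks {I J : Type*} [Fintype I] [Fintype J]
    {M : Matrix (I × J) (I × J) ℂ} (hM : M.PosSemidef) :
    (of fun s t => ∑ a, ∑ b, M (s, a) (t, b) : Matrix I I ℂ).PosSemidef := by
  refine PosSemidef.of_dotProduct_mulVec_nonneg ?_ fun x => ?_
  · ext s t
    simp only [conjTranspose_apply, of_apply, star_sum, hM.isHermitian.apply]
    exact Finset.sum_comm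
  · convert hM.dotProduct_mulVec_nonneg (fun sa => x sa.1) using 1
    simp only [dotProduct, mulVec, of_apply, Fintype.sum_prod_type, Pi.star_apply, Finset.sum_mul,
      Finset.mul_sum]
    refine Finset.sum_congr rfl fun s _ => ?_
    rw [Finset.sum_comm]

theorem mem_matCones_iff {n p : ℕ} (A : Matrix (Fin p) (Fin p) (Mat n)) :
    A ∈ matCones n p ↔ (comp (Fin p) (Fin p) (Fin n) (Fin n) ℂ A).PosSemidef := Iff.rfl

/-- The duality map of the matrix units preserves and reflects the matrix orderings. -/
theorem map_toDual_mem_dualCones_iff {n p : ℕ} (A : Matrix (Fin p) (Fin p) (Mat n)) :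
    A.map (matrixUnits n).toDual ∈ dualCones (matCones n) p ↔ A ∈ matCones n p := by
  constructor
  · intro h
    -- The Choi matrix: evaluating the functionals on `(E_kl)` recovers the entries of `A`, up to
    -- exchanging the tensor factors.
    have hY : (of fun k l => single k l 1 : Matrix (Fin n) (Fin n) (Mat n)) ∈ matCones n n := by
      have := posSemidef_vecMulVec_self_star
        (fun ka : Fin n × Fin n => if ka.1 = ka.2 then (1 : ℂ) else 0)
      rw [mem_matCones_iff]
      convert this using 1
      ext ⟨k, a⟩ ⟨l, b⟩
      simp [comp_apply, vecMulVec_apply, single_apply, ← ite_and, and_comm]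
    have h1 := PosSemidef.submatrix (h n _ hY) (Prod.swap : Fin p × Fin n → Fin n × Fin p)
    rw [mem_matCones_iff]
    convert h1 using 1
    ext ⟨i, k⟩ ⟨j, l⟩
    change A i j k l = (matrixUnits n).toDual (A i j) (single k l 1)
    rw [← stdBasis_eq_single, Module.Basis.toDual_apply_left]
    rfl
  · intro h q Y hY
    -- A Schur product: restricting the Kronecker product to equal inner indices gives `Y_kl(a,b)
    -- A_ij(a,b)`, and summing over `a, b` gives the pairing.
    have h1 := (PosSemidef.kronecker hY h).submatrix
      (fun s : (Fin q × Fin p) × Fin n => ((s.1.1, s.2), (s.1.2, s.2)))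
    rw [mem_matCones_iff]
    convert posSemidef_sum_blocks h1 using 1
    ext ⟨k, i⟩ ⟨l, j⟩
    change (matrixUnits n).toDual (A i j) (Y k l) = _
    rw [matrixUnits_toDual_apply]
    exact Finset.sum_congr rfl fun a _ => Finset.sum_congr rfl fun b _ => mul_comm _ _

theorem matrixUnits_toDual_mem_posFunctional_iff {n : ℕ} (X : Mat n) :
    (matrixUnits n).toDual X ∈ posFunctional n ↔ X.PosSemidef := by
  rw [mem_posFunctional_iff]
  exact (map_toDual_mem_dualCones_iff (of fun _ _ : Fin 1 => X)).trans (mem_posMat_iff X).symm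

/-- The amplification of `Φ_C` is congruence by the block diagonal matrix `1 ⊗ C`. -/
theorem map_conjMap_mem_matCones {n p : ℕ} (C : Mat n) {A : Matrix (Fin p) (Fin p) (Mat n)}
    (hA : A ∈ matCones n p) : A.map (conjMap C) ∈ matCones n p := by
  have h := PosSemidef.mul_mul_conjTranspose_same hA
    (of fun (s t : Fin p × Fin n) => if s.1 = t.1 then C s.2 t.2 else 0)
  rw [mem_matCones_iff]
  convert h using 1
  ext ⟨i, a⟩ ⟨j, b⟩
  change (C * A i j * Cᴴ) a b = _
  simp [mul_apply, Fintype.sum_prod_type, comp_apply, Finset.sum_ite_irrel,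
    apply_ite (starRingEnd ℂ)]

theorem isCompleteOrderIso_of_bijective {V W : Type*} [AddCommGroup V] [Module ℂ V]
    [AddCommGroup W] [Module ℂ W] {P : MatrixCones V} {Q : MatrixCones W} {Φ : V →ₗ[ℂ] W}
    (hΦ : Function.Bijective Φ) (h : ∀ p (A : Matrix (Fin p) (Fin p) V), A.map Φ ∈ Q p ↔ A ∈ P p) :
    IsCompleteOrderIso P Q Φ := by
  refine ⟨LinearEquiv.ofBijective Φ hΦ, rfl, fun p A hA => (h p A).2 hA, fun p A hA => ?_⟩
  rw [← h]
  convert hA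
  ext i j
  exact LinearEquiv.apply_symm_apply (LinearEquiv.ofBijective Φ hΦ) _

/-- `D_E ∘ Φ_C` is a complete order isomorphism for invertible `C`. -/
theorem isCompleteOrderIso_toDual_comp_conjMap {n : ℕ} {C D : Mat n} (hCD : C * D = 1) :
    IsCompleteOrderIso (matCones n) (dualCones (matCones n))
      ((matrixUnits n).toDual ∘ₗ conjMap C) := by
  have hDC : D * C = 1 := mul_eq_one_comm.1 hCD
  have hid : conjMap (1 : Mat n) = LinearMap.id := LinearMap.ext fun X => by simp [conjMap_apply]
  have h1 (X : Mat n) : conjMap D (conjMap C X) = X := by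
    rw [← LinearMap.comp_apply, conjMap_comp, hDC, hid, LinearMap.id_apply]
  have h2 (X : Mat n) : conjMap C (conjMap D X) = X := by
    rw [← LinearMap.comp_apply, conjMap_comp, hCD, hid, LinearMap.id_apply]
  refine isCompleteOrderIso_of_bijective ?_ fun p A => ?_
  · rw [LinearMap.coe_comp]
    have hb : Function.Bijective (matrixUnits n).toDual :=
      ⟨(matrixUnits n).toDual_injective, LinearMap.range_eq_top.1 (matrixUnits n).toDual_range⟩
    exact hb.comp
      (Function.bijective_iff_has_inverse.2 ⟨conjMap D, h1, h2⟩)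
  · rw [LinearMap.coe_comp, ← Matrix.map_map, map_toDual_mem_dualCones_iff]
    refine ⟨fun h => ?_, map_conjMap_mem_matCones C⟩
    have h3 : (A.map (conjMap C)).map (conjMap D) = A :=
      funext fun i => funext fun j => h1 (A i j)
    exact h3 ▸ map_conjMap_mem_matCones D h

/-! ### Factorization of the duality map of a general basis -/

theorem toDual_superTranspose {n : ℕ} (L : Mat n →ₗ[ℂ] Mat n) (X Y : Mat n) :
    (matrixUnits n).toDual (superTranspose L X) Y = (matrixUnits n).toDual X (L Y) := by
  suffices h : (matrixUnits n).toDual ∘ₗ superTranspose L =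
      L.dualMap ∘ₗ (matrixUnits n).toDual from LinearMap.congr_fun (LinearMap.congr_fun h X) Y
  refine (matrixUnits n).ext fun s => (matrixUnits n).ext fun t => ?_
  change (matrixUnits n).toDual (superTranspose L (matrixUnits n s)) (matrixUnits n t) =
    (matrixUnits n).toDual (matrixUnits n s) (L (matrixUnits n t))
  rw [Module.Basis.toDual_apply_left, Module.Basis.toDual_apply_right, superTranspose,
    ← LinearMap.toMatrix_apply, ← LinearMap.toMatrix_apply, LinearMap.toMatrix_toLin,
    transpose_apply]

theorem dualityMap_comp_eq_toDual {n : ℕ} {ι : Type*} [DecidableEq ι]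
    (B : Module.Basis ι ℂ (Mat n)) {L : Mat n →ₗ[ℂ] Mat n} (hL : IsChangeOfBasis B L) :
    dualityMap B ∘ₗ (L ∘ₗ superTranspose L) = (matrixUnits n).toDual := by
  -- Only an equality of sets is given, so the matching of indices is chosen; it is surjective, and
  -- bijective by finiteness.
  have hmem : ∀ s, ∃ i, B i = L (matrixUnits n s) := fun s =>
    hL.subset ⟨_, ⟨s, rfl⟩, rfl⟩
  choose σ hσ using hmem
  have hsurj : Function.Surjective σ := by
    intro i
    obtain ⟨_, ⟨s, rfl⟩, hs⟩ := hL.superset ⟨i, rfl⟩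
    exact ⟨s, B.injective ((hσ s).trans hs)⟩
  have hinj : Function.Injective σ := by
    let e := (matrixUnits n).indexEquiv B
    have : Function.Injective (e.symm ∘ σ) :=
      Finite.injective_iff_surjective.2 (e.symm.surjective.comp hsurj)
    exact this.of_comp
  have hLs : Function.Surjective L := by
    rw [← LinearMap.range_eq_top, eq_top_iff, ← B.span_eq, Submodule.span_le]
    rintro _ ⟨i, rfl⟩
    obtain ⟨s, rfl⟩ := hsurj i
    exact ⟨_, (hσ s).symm⟩
  have key (X Y : Mat n) : dualityMap B (L X) (L Y) = (matrixUnits n).toDual X Y := by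
    suffices h : L.dualMap ∘ₗ dualityMap B ∘ₗ L = (matrixUnits n).toDual from
      LinearMap.congr_fun (LinearMap.congr_fun h X) Y
    refine (matrixUnits n).ext fun s => (matrixUnits n).ext fun t => ?_
    change dualityMap B (L (matrixUnits n s)) (L (matrixUnits n t)) = _
    rw [← hσ, ← hσ, Module.Basis.toDual_apply, Module.Basis.toDual_apply]
    simp [hinj.eq_iff]
  refine LinearMap.ext fun X => LinearMap.ext fun Y => ?_
  obtain ⟨Y, rfl⟩ := hLs Y
  change dualityMap B (L (superTranspose L X)) (L Y) = _
  rw [key, toDual_superTranspose]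

/-- If `Φ_C` is surjective, then `C` is invertible. -/
theorem exists_mul_eq_one_of_surjective {n : ℕ} {C : Mat n}
    (h : Function.Surjective (conjMap C)) : ∃ D, D * C = 1 := by
  obtain ⟨X, hX⟩ := h 1
  rw [conjMap_apply, mul_assoc] at hX
  exact ⟨_, mul_eq_one_comm.1 hX⟩

theorem isOrderIso_dualityMap_iff {n : ℕ} {ι : Type*} [DecidableEq ι]
    (B : Module.Basis ι ℂ (Mat n)) {M : Mat n →ₗ[ℂ] Mat n} (hM : Function.Surjective M)
    (h : dualityMap B ∘ₗ M = (matrixUnits n).toDual) :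
    IsOrderIso (posMat n) (posFunctional n) (dualityMap B) ↔
      ∀ X, (M X).PosSemidef ↔ X.PosSemidef := by
  have hM' (X : Mat n) : dualityMap B (M X) = (matrixUnits n).toDual X := LinearMap.congr_fun h X
  constructor
  · rintro ⟨e, he, h1, h2⟩ X
    have h3 : e (M X) = (matrixUnits n).toDual X := by
      rw [← hM', ← he]; rfl
    rw [← matrixUnits_toDual_mem_posFunctional_iff X, ← h3]
    exact ⟨h1 _, fun h4 => by simpa [posMat] using h2 _ h4⟩
  · intro hX
    have : Finite ι := Module.Finite.finite_basis B
    have h1 (Y : Mat n) : dualityMap B Y ∈ posFunctional n ↔ Y ∈ posMat n := by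
      obtain ⟨X, rfl⟩ := hM Y
      rw [hM', matrixUnits_toDual_mem_posFunctional_iff]
      exact (hX X).symm
    refine ⟨B.toDualEquiv, rfl, fun v hv => (h1 v).2 hv, fun w hw => (h1 _).1 ?_⟩
    change B.toDualEquiv (B.toDualEquiv.symm w) ∈ _
    rwa [LinearEquiv.apply_symm_apply]

end MatrixDuality

end

/-! ### The main theorem -/

open MatrixDuality

theorem mainTheorem1 {n : ℕ} {ι : Type*} [DecidableEq ι]
    (B : Module.Basis ι ℂ (MatrixDuality.Mat n))
    (CB MB : MatrixDuality.Mat n →ₗ[ℂ] MatrixDuality.Mat n)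
    (hCB : MatrixDuality.IsChangeOfBasis B CB)
    (hMB : MB = CB ∘ₗ MatrixDuality.superTranspose CB) :
    (MatrixDuality.IsOrderIso (MatrixDuality.posMat n) (MatrixDuality.posFunctional n)
        (MatrixDuality.dualityMap B) ↔
      ∃ C : MatrixDuality.Mat n, MB = MatrixDuality.conjMap C ∨
        MB = MatrixDuality.transposeMap n ∘ₗ MatrixDuality.conjMap C) ∧
    ((∃ C : MatrixDuality.Mat n, MB = MatrixDuality.conjMap C) →
      MatrixDuality.IsCompleteOrderIso (MatrixDuality.matCones n)
        (MatrixDuality.dualCones (MatrixDuality.matCones n)) (MatrixDuality.dualityMap B)) ∧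
    ((∃ C : MatrixDuality.Mat n, MB = MatrixDuality.transposeMap n ∘ₗ MatrixDuality.conjMap C) →
      MatrixDuality.IsCoPositiveOrderIso (MatrixDuality.dualityMap B)) := by
  have hDM : dualityMap B ∘ₗ MB = (matrixUnits n).toDual := by
    rw [hMB]; exact dualityMap_comp_eq_toDual B hCB
  have hfin : Finite ι := Module.Finite.finite_basis B
  have hbij : Function.Bijective MB := by
    have h1 : Function.Bijective (B.toDualEquiv ∘ MB) := by
      have : (B.toDualEquiv ∘ MB : _ → _) = (matrixUnits n).toDualEquiv :=
        funext fun X => LinearMap.congr_fun hDM X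
      rw [this]
      exact (matrixUnits n).toDualEquiv.bijective
    exact (Function.Bijective.of_comp_iff' B.toDualEquiv.bijective MB).1 h1
  have htt : transposeMap n ∘ₗ transposeMap n = LinearMap.id := LinearMap.ext fun X => rfl
  have hid : conjMap (1 : Mat n) = LinearMap.id := LinearMap.ext fun X => by simp [conjMap_apply]
  have hconj (C : Mat n) (h : MB = conjMap C) : ∃ D, D * C = 1 :=
    exists_mul_eq_one_of_surjective (h ▸ hbij.surjective)
  have htconj (C : Mat n) (h : MB = transposeMap n ∘ₗ conjMap C) : ∃ D, D * C = 1 := by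
    refine exists_mul_eq_one_of_surjective ?_
    have h1 : conjMap C = transposeMap n ∘ₗ MB := by
      rw [h, ← LinearMap.comp_assoc, htt, LinearMap.id_comp]
    rw [h1]
    intro Y
    obtain ⟨X, hX⟩ := hbij.surjective (transposeMap n Y)
    exact ⟨X, by rw [LinearMap.comp_apply, hX]; rfl⟩
  refine ⟨?_, ?_, ?_⟩
  · rw [isOrderIso_dualityMap_iff B hbij.surjective hDM]
    refine ⟨exists_conjMap_of_orderAutomorphism hbij, ?_⟩
    rintro ⟨C, h | h⟩ X
    · obtain ⟨D, hD⟩ := hconj C h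
      rw [h, posSemidef_conjMap_iff (IsUnit.of_mul_eq_one_right D hD)]
    · obtain ⟨D, hD⟩ := htconj C h
      rw [h, LinearMap.comp_apply, transposeMap_apply, Matrix.posSemidef_transpose_iff,
        posSemidef_conjMap_iff (IsUnit.of_mul_eq_one_right D hD)]
  · rintro ⟨C, h⟩
    obtain ⟨D, hD⟩ := hconj C h
    have h1 : dualityMap B = (matrixUnits n).toDual ∘ₗ conjMap D := by
      rw [← hDM, LinearMap.comp_assoc, h, conjMap_comp, mul_eq_one_comm.1 hD, hid,
        LinearMap.comp_id]
    rw [h1]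
    exact isCompleteOrderIso_toDual_comp_conjMap hD
  · rintro ⟨C, h⟩
    obtain ⟨D, hD⟩ := htconj C h
    have h1 : dualityMap B ∘ₗ transposeMap n = (matrixUnits n).toDual ∘ₗ conjMap D := by
      have h2 : transposeMap n = MB ∘ₗ conjMap D := by
        rw [h, LinearMap.comp_assoc, conjMap_comp, mul_eq_one_comm.1 hD, hid, LinearMap.comp_id]
      rw [h2, ← LinearMap.comp_assoc, hDM]
    -- The pairing is unchanged when both arguments are transposed, so `t` passes through `D_E`;
    -- moving it past `Φ_D` conjugates the entries of `D`, and the two transposes cancel.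
    have h3 : (transposeMap n).dualMap ∘ₗ dualityMap B =
        (matrixUnits n).toDual ∘ₗ conjMap (D.map star) := by
      have h4 : dualityMap B = (matrixUnits n).toDual ∘ₗ conjMap D ∘ₗ transposeMap n := by
        rw [← LinearMap.comp_assoc, ← h1, LinearMap.comp_assoc, htt, LinearMap.comp_id]
      have h5 : (transposeMap n).dualMap ∘ₗ (matrixUnits n).toDual =
          (matrixUnits n).toDual ∘ₗ transposeMap n :=
        LinearMap.ext fun X => LinearMap.ext fun Y => matrixUnits_toDual_transpose X Y
      rw [h4, conjMap_comp_transposeMap, ← LinearMap.comp_assoc, h5, LinearMap.comp_assoc,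
        ← LinearMap.comp_assoc _ (transposeMap n) (transposeMap n), htt, LinearMap.id_comp]
    refine ⟨h1 ▸ isCompleteOrderIso_toDual_comp_conjMap hD,
      h3 ▸ isCompleteOrderIso_toDual_comp_conjMap (D := C.map star) ?_⟩
    have h6 := congrArg (fun X : Mat n => X.map (starRingEnd ℂ)) hD
    simpa [Matrix.map_mul] using h6
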